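/- Words have letters in $\{0,1,2,\dots\}$. A word $\pi=\pi(1)\pi(2)\cdots\pi(n)$ is a *faro word* if its odd-position subsequence $\pi_o=\pi(1)\pi(3)\pi(5)\cdots$ and its even-position subsequence $\pi_e=\pi(2)\pi(4)\pi(6)\cdots$ are both nondecreasing, and it is *subexcedent* if $\pi(i)\le i-1$ for $1\le i\le n$ (so that its letters lie in $\{0,\dots,n-1\}$). For such a word let $\mathrm{eOdis}(\pi)$ be the number of distinct positive even letters in $\pi_o$, $\mathrm{oOdis}(\pi)$ the number of distinct odd letters in $\pi_o$, and $\mathrm{aOrpt}(\pi)$ the number of indices $i\ge 1$ with $2i+1\le n$ and $\pi(2i-1)=\pi(2i+1)$; let $\mathrm{eEdis}(\pi)$ be the number of distinct even letters in $\pi_e$ (here $0$ is counted if it occurs), $\mathrm{oEdis}(\pi)$ the number of distinct odd letters in $\pi_e$, and $\mathrm{aErpt}(\pi)$ the number of indices $i\ge 1$ with $2i+2\le n$ and $\pi(2i)=\pi(2i+2)$. Let $n\ge 2$, $n_o=\lfloor (n+1)/2\rfloor$ and $n_e=\lfloor n/2\rfloor$. Every subexcedent faro word $\pi$ of length $n$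 satisfies $$\mathrm{eOdis}(\pi)+\mathrm{oOdis}(\pi)+\mathrm{aOrpt}(\pi)=n_o-1,\qquad \mathrm{eEdis}(\pi)+\mathrm{oEdis}(\pi)+\mathrm{aErpt}(\pi)=n_e,$$ and, for all nonnegative integers $r_1,\dots,r_6$ with $r_1+r_2+r_3=n_o-1$ and $r_4+r_5+r_6=n_e$, the number of subexcedent faro words $\pi$ of length $n$ such that $$(\mathrm{eOdis},\mathrm{oOdis},\mathrm{aOrpt},\mathrm{eEdis},\mathrm{oEdis},\mathrm{aErpt})(\pi)=(r_1,r_2,r_3,r_4,r_5,r_6)$$ is $$\frac{1}{n_o}\binom{n_o}{r_1}\binom{n_o}{r_2}\binom{n_o}{r_3}\,\frac{r_4+r_5}{n_e(n_e+1)}\binom{n_e+1}{r_4}\binom{n_e+1}{r_5}\binom{n_e}{r_6}.$$ -/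

import Mathlib

/-! A word of length `n` over the `k`-ary alphabet `{0, …, k-1}` is a function `Fin n → Fin k`.
Positions are numbered from `0` in the code, so the `i`-th letter `w_i` (with `1 ≤ i ≤ n`) is the
value at `i - 1`, and the odd positions `1, 3, 5, …` are the even indices `0, 2, 4, …`. -/

namespace FaroWord

/-- The faro shuffle `u₁ v₁ u₂ v₂ u₃ …` of two words whose lengths `⌊(n+1)/2⌋` and `⌊n/2⌋`
add up to `n` (and hence differ by at most one). -/
def faroShuffle {n k : ℕ} (u : Fin ((n + 1) / 2) → Fin k) (v : Fin (n / 2) → Fin k) :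
    Fin n → Fin k :=
  fun i => if h : (i : ℕ) % 2 = 0 then u ⟨(i : ℕ) / 2, by omega⟩ else v ⟨(i : ℕ) / 2, by omega⟩

/-- A faro word is a faro shuffle of two nondecreasing words. -/
def IsFaro {n k : ℕ} (w : Fin n → Fin k) : Prop :=
  ∃ (u : Fin ((n + 1) / 2) → Fin k) (v : Fin (n / 2) → Fin k),
    Monotone u ∧ Monotone v ∧ w = faroShuffle u v

/-- A word is subexcedent if `w_i ≤ i - 1` for `1 ≤ i ≤ n`. -/
def IsSubexcedent {n k : ℕ} (w : Fin n → Fin k) : Prop :=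
  ∀ i : Fin n, (w i : ℕ) ≤ (i : ℕ)

/-- The subsequence `w₁ w₃ w₅ …` of the letters in odd positions. -/
def oddPart {n k : ℕ} (w : Fin n → Fin k) : Fin ((n + 1) / 2) → Fin k :=
  fun i => w ⟨2 * (i : ℕ), by omega⟩

/-- The subsequence `w₂ w₄ w₆ …` of the letters in even positions. -/
def evenPart {n k : ℕ} (w : Fin n → Fin k) : Fin (n / 2) → Fin k :=
  fun i => w ⟨2 * (i : ℕ) + 1, by omega⟩

/-- The finite set of (distinct) letters of a word. -/
def letters {m k : ℕ} (u : Fin m → Fin k) : Finset ℕ :=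
  Finset.univ.image fun i => (u i : ℕ)

/-- The number of positions of a word at which the letter equals the next letter. -/
def repetitions {m k : ℕ} (u : Fin m → Fin k) : ℕ :=
  (Finset.univ.filter fun i : Fin m => ∃ h : (i : ℕ) + 1 < m, u i = u ⟨(i : ℕ) + 1, h⟩).card

/-- The number of distinct positive even letters in odd positions. -/
def eOdis {n k : ℕ} (w : Fin n → Fin k) : ℕ :=
  ((letters (oddPart w)).filter fun a => 0 < a ∧ Even a).card

/-- The number of distinct odd letters in odd positions. -/
def oOdis {n k : ℕ} (w : Fin n → Fin k) : ℕ :=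
  ((letters (oddPart w)).filter fun a => Odd a).card

/-- The number of letter repetitions in the subsequence of odd positions. -/
def aOrpt {n k : ℕ} (w : Fin n → Fin k) : ℕ :=
  repetitions (oddPart w)

/-- The number of distinct even letters (including `0`) in even positions. -/
def eEdis {n k : ℕ} (w : Fin n → Fin k) : ℕ :=
  ((letters (evenPart w)).filter fun a => Even a).card

/-- The number of distinct odd letters in even positions. -/
def oEdis {n k : ℕ} (w : Fin n → Fin k) : ℕ :=
  ((letters (evenPart w)).filter fun a => Odd a).card

/-- The number of letter repetitions in the subsequence of even positions. -/
def aErpt {n k : ℕ} (w : Fin n → Fin k) : ℕ :=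
  repetitions (evenPart w)

/-- The set of subexcedent faro words of length `n` over the alphabet `{0, …, n-1}`. -/
def subexcedentFaroWords (n : ℕ) : Set (Fin n → Fin n) :=
  {w | IsFaro w ∧ IsSubexcedent w}

end FaroWord

namespace FaroWord

/-! The odd-position and even-position subsequences can be chosen independently, so the count is a
product of two counts.

A nondecreasing word of length `m` is determined by its letter set and by the positions repeated at
the next place; the two cardinalities add up to `m`. For an odd-position word record, in step `j`,
three bits: whether the letters `2j+2` and `2j+1` occur and whether position `j` is repeated.
Counting the letters below `u i` and below `2i+1` turns the bound `u i ≤ 2i` into positivity of a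
path that starts at height 1, and the mark totals make it end at height 0 (`letter_le_iff`,
`wordPath_injOn`, `exists_wordPath_eq`). Such paths are counted by a ballot theorem with factor `k /
m`, where `k` is the starting height (`mul_pathCount`).

An even-position word becomes an odd-position word, one letter longer, by raising its letters and
prepending 0. The image consists of the words whose initial 0 is not repeated, so the first step is
restricted and the ballot theorem applies to the remaining steps (`ncard_isEvenWord`,
`mul_ncard_positivePath_first_false`). -/

/-- The sum of the values of `g` at the first `i` indices. -/
def partialSum {m : ℕ} (g : Fin m → ℕ) (i : ℕ) : ℕ :=
  ∑ j ∈ Finset.univ.filter fun j : Fin m => (j : ℕ) < i, g j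

@[simp]
theorem partialSum_zero {m : ℕ} (g : Fin m → ℕ) : partialSum g 0 = 0 := by
  simp [partialSum]

theorem partialSum_succ {m : ℕ} (g : Fin m → ℕ) {i : ℕ} (hi : i < m) :
    partialSum g (i + 1) = partialSum g i + g ⟨i, hi⟩ := by
  have h : (Finset.univ.filter fun j : Fin m => (j : ℕ) < i + 1) =
      insert ⟨i, hi⟩ (Finset.univ.filter fun j : Fin m => (j : ℕ) < i) := by
    ext j
    simp [Fin.ext_iff]
    omega
  rw [partialSum, h, Finset.sum_insert (by simp), add_comm, partialSum]

theorem partialSum_self {m : ℕ} (g : Fin m → ℕ) : partialSum g m = ∑ j, g j := by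
  simp [partialSum]

theorem partialSum_add {m : ℕ} (f g : Fin m → ℕ) (i : ℕ) :
    partialSum (fun j => f j + g j) i = partialSum f i + partialSum g i :=
  Finset.sum_add_distrib

theorem partialSum_fin_succ {m : ℕ} (g : Fin (m + 1) → ℕ) (i : ℕ) :
    partialSum g (i + 1) = g 0 + partialSum (fun j => g j.succ) i := by
  simp [partialSum, Finset.sum_filter, Fin.sum_univ_succ]

/-! ### Marked paths and the ballot theorem -/

/-- The number of marks set in a step. -/
def stepHeight (e : Bool × Bool × Bool) : ℕ :=
  e.1.toNat + e.2.1.toNat + e.2.2.toNat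

/-- A path starting at height `k`, each step of which goes down by one and then up by its number of
marks, is positive if its height is positive before each of its steps. -/
def IsPositivePath (k : ℕ) {m : ℕ} (x : Fin m → Bool × Bool × Bool) : Prop :=
  ∀ i < m, i + 1 ≤ k + partialSum (fun j => stepHeight (x j)) i

/-- The path `x`, preceded by the step `e`, has the given total numbers of marks. -/
def HasMarks (e : Bool × Bool × Bool) (r₁ r₂ r₃ : ℕ) {m : ℕ} (x : Fin m → Bool × Bool × Bool) :
    Prop :=
  e.1.toNat + ∑ j, (x j).1.toNat = r₁ ∧ e.2.1.toNat + ∑ j, (x j).2.1.toNat = r₂ ∧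
    e.2.2.toNat + ∑ j, (x j).2.2.toNat = r₃

theorem isPositivePath_cons (k : ℕ) {m : ℕ} (e : Bool × Bool × Bool)
    (x : Fin m → Bool × Bool × Bool) :
    IsPositivePath (k + 1) (Fin.cons e x : Fin (m + 1) → Bool × Bool × Bool) ↔
      IsPositivePath (k + stepHeight e) x := by
  constructor
  · intro h i hi
    have := h (i + 1) (by omega)
    rw [partialSum_fin_succ] at this
    simp only [Fin.cons_zero, Fin.cons_succ] at this
    omega
  · intro h i hi
    cases i with
    | zero => omega
    | succ i =>
      have := h i (by omega)
      rw [partialSum_fin_succ]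
      simp only [Fin.cons_zero, Fin.cons_succ]
      omega

theorem hasMarks_cons (e : Bool × Bool × Bool) (r₁ r₂ r₃ : ℕ) {m : ℕ}
    (x : Fin m → Bool × Bool × Bool) :
    HasMarks (false, false, false) r₁ r₂ r₃ (Fin.cons e x : Fin (m + 1) → Bool × Bool × Bool) ↔
      HasMarks e r₁ r₂ r₃ x := by
  simp [HasMarks, Fin.sum_univ_succ]

/-- The number of positive paths with the given total numbers of marks, where the marks of `e` are
counted as well. -/
noncomputable def pathCount (k m : ℕ) (e : Bool × Bool × Bool) (r₁ r₂ r₃ : ℕ) : ℕ :=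
  {x : Fin m → Bool × Bool × Bool | IsPositivePath k x ∧ HasMarks e r₁ r₂ r₃ x}.ncard

/-- The predicate `P` lets one decomposition serve both the unrestricted recursion and the count
with a restricted first step. -/
theorem ncard_positivePath_first_step (k m r₁ r₂ r₃ : ℕ) (P : Bool × Bool × Bool → Prop)
    [DecidablePred P] :
    {x : Fin (m + 1) → Bool × Bool × Bool |
      P (x 0) ∧ IsPositivePath (k + 1) x ∧ HasMarks (false, false, false) r₁ r₂ r₃ x}.ncard =
      ∑ e, if P e then pathCount (k + stepHeight e) m e r₁ r₂ r₃ else 0 := by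
  classical
  rw [Set.ncard_eq_toFinset_card', Set.toFinset_ofPred, Finset.card_filter, ← (Fin.consEquiv fun _ : Fin (m + 1) => Bool × Bool × Bool).sum_comp,
    Fintype.sum_prod_type]
  refine Finset.sum_congr rfl fun e _ => ?_
  have hc : ∀ x : Fin m → Bool × Bool × Bool,
      Fin.consEquiv (fun _ : Fin (m + 1) => Bool × Bool × Bool) (e, x) =
        (Fin.cons e x : Fin (m + 1) → Bool × Bool × Bool) := fun _ => rfl
  simp only [hc, Fin.cons_zero, isPositivePath_cons, hasMarks_cons]
  split_ifs with h
  · rw [pathCount, Set.ncard_eq_toFinset_card', Set.toFinset_ofPred, Finset.card_filter]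
    simp only [h, true_and]
  · simp [h]

theorem pathCount_succ (k m r₁ r₂ r₃ : ℕ) :
    pathCount (k + 1) (m + 1) (false, false, false) r₁ r₂ r₃ =
      ∑ e, pathCount (k + stepHeight e) m e r₁ r₂ r₃ := by
  rw [pathCount]
  simpa only [if_true, true_and] using ncard_positivePath_first_step k m r₁ r₂ r₃ fun _ => True

theorem pathCount_zero_left (m : ℕ) (e : Bool × Bool × Bool) (r₁ r₂ r₃ : ℕ) :
    pathCount 0 (m + 1) e r₁ r₂ r₃ = 0 := by
  rw [pathCount, Set.ncard_eq_zero, Set.eq_empty_iff_forall_notMem]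
  rintro x ⟨h, -⟩
  simpa using h 0 (by omega)

/-- The number of `r`-element subsets of a set with `m + 1` elements that contain a distinguished
element or not, according to `b`. -/
def chooseFirst (m r : ℕ) (b : Bool) : ℕ :=
  if b then (if r = 0 then 0 else m.choose (r - 1)) else m.choose r

theorem chooseFirst_add (m r : ℕ) :
    chooseFirst m r false + chooseFirst m r true = (m + 1).choose r := by
  cases r with
  | zero => simp [chooseFirst]
  | succ r => simp [chooseFirst, Nat.choose_succ_succ, add_comm]

theorem mul_chooseFirst_true (m r : ℕ) :
    (m + 1) * chooseFirst m r true = r * (m + 1).choose r := by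
  cases r with
  | zero => simp [chooseFirst]
  | succ r => simp [chooseFirst, Nat.add_one_mul_choose_eq, mul_comm (r + 1)]

/-- The count of paths that are preceded by an extra step follows from the count of paths alone. -/
theorem mul_pathCount_of_false {k m : ℕ}
    (h : ∀ r₁ r₂ r₃, r₁ + r₂ + r₃ + k = m →
      m * pathCount k m (false, false, false) r₁ r₂ r₃ =
        k * (m.choose r₁ * m.choose r₂ * m.choose r₃))
    (e : Bool × Bool × Bool) (r₁ r₂ r₃ : ℕ) (hr : r₁ + r₂ + r₃ + k = m + stepHeight e) :
    m * pathCount k m e r₁ r₂ r₃ =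
      k * (chooseFirst m r₁ e.1 * chooseFirst m r₂ e.2.1 * chooseFirst m r₃ e.2.2) := by
  by_cases hle : e.1.toNat ≤ r₁ ∧ e.2.1.toNat ≤ r₂ ∧ e.2.2.toNat ≤ r₃
  · have hc : ∀ (r : ℕ) (b : Bool), b.toNat ≤ r → chooseFirst m r b = m.choose (r - b.toNat) := by
      intro r b hb
      cases b
      · simp [chooseFirst]
      · have : r ≠ 0 := by
          simp at hb
          omega
        simp [chooseFirst, this]
    rw [hc _ _ hle.1, hc _ _ hle.2.1, hc _ _ hle.2.2, ← h]
    · congr 1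
      rw [pathCount, pathCount]
      congr 1
      ext x
      simp only [HasMarks, Bool.toNat_false, Set.mem_ofPred_eq]
      exact and_congr Iff.rfl (by omega)
    · simp only [stepHeight] at hr
      omega
  -- If `e` already has more marks than some total allows, both sides vanish; this is where
  -- `chooseFirst` being 0 at `r = 0` with a set mark is needed.
  · have h0 : pathCount k m e r₁ r₂ r₃ = 0 := by
      rw [pathCount, Set.ncard_eq_zero, Set.eq_empty_iff_forall_notMem]
      rintro x ⟨-, h₁, h₂, h₃⟩
      omega
    have hz : ∀ (r : ℕ) (b : Bool), ¬ b.toNat ≤ r → chooseFirst m r b = 0 := by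
      intro r b hb
      cases b
      · simp at hb
      · have : r = 0 := by
          simp at hb
          omega
        simp [chooseFirst, this]
    rw [h0, mul_zero]
    by_cases h₁ : e.1.toNat ≤ r₁
    · by_cases h₂ : e.2.1.toNat ≤ r₂
      · simp [hz r₃ e.2.2 fun h₃ => hle ⟨h₁, h₂, h₃⟩]
      · simp [hz _ _ h₂]
    · simp [hz _ _ h₁]

/-- The generalised ballot theorem for positive paths that end at height zero. -/
theorem mul_pathCount (m : ℕ) : ∀ k r₁ r₂ r₃ : ℕ, r₁ + r₂ + r₃ + k = m →
    m * pathCount k m (false, false, false) r₁ r₂ r₃ =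
      k * (m.choose r₁ * m.choose r₂ * m.choose r₃) := by
  induction m with
  | zero =>
    intro k r₁ r₂ r₃ h
    obtain rfl : k = 0 := by omega
    simp
  | succ m ih =>
    intro k r₁ r₂ r₃ h
    cases k with
    | zero => simp [pathCount_zero_left]
    | succ k =>
      -- The induction hypothesis carries a factor `m` that is cancelled at the end, so a path of
      -- one step is treated by hand: only the unmarked step contributes.
      rcases Nat.eq_zero_or_pos m with rfl | hm
      · obtain ⟨rfl, rfl, rfl, rfl⟩ : r₁ = 0 ∧ r₂ = 0 ∧ r₃ = 0 ∧ k = 0 := by omega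
        rw [pathCount_succ, Fintype.sum_eq_single (false, false, false)]
        · simp [pathCount, HasMarks, IsPositivePath]
        · rintro ⟨a, b, c⟩ hne
          rw [pathCount, Set.ncard_eq_zero, Set.eq_empty_iff_forall_notMem]
          rintro x ⟨-, h₁, h₂, h₃⟩
          cases a <;> cases b <;> cases c <;> simp_all
      · have key : m * pathCount (k + 1) (m + 1) (false, false, false) r₁ r₂ r₃ =
            ∑ e : Bool × Bool × Bool, (k + stepHeight e) *
              (chooseFirst m r₁ e.1 * chooseFirst m r₂ e.2.1 * chooseFirst m r₃ e.2.2) := by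
          rw [pathCount_succ, Finset.mul_sum]
          refine Finset.sum_congr rfl fun e _ => ?_
          exact mul_pathCount_of_false (ih _) e r₁ r₂ r₃ (by omega)
        simp only [Fintype.sum_prod_type, Fintype.sum_bool, stepHeight, Bool.toNat_true,
          Bool.toNat_false] at key
        have a₁ := chooseFirst_add m r₁
        have a₂ := chooseFirst_add m r₂
        have a₃ := chooseFirst_add m r₃
        have b₁ := mul_chooseFirst_true m r₁
        have b₂ := mul_chooseFirst_true m r₂
        have b₃ := mul_chooseFirst_true m r₃
        generalize pathCount (k + 1) (m + 1) (false, false, false) r₁ r₂ r₃ = N at *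
        rw [← a₁] at b₁ ⊢
        rw [← a₂] at b₂ ⊢
        rw [← a₃] at b₃ ⊢
        generalize chooseFirst m r₁ false = p₁ at *
        generalize chooseFirst m r₂ false = p₂ at *
        generalize chooseFirst m r₃ false = p₃ at *
        generalize chooseFirst m r₁ true = q₁ at *
        generalize chooseFirst m r₂ true = q₂ at *
        generalize chooseFirst m r₃ true = q₃ at *
        refine Nat.eq_of_mul_eq_mul_left hm ?_
        zify at *
        -- Pascal's rule collapses the sum over first steps, and absorption turns each marked term
        -- into a factor `r / (m + 1)`. What remains is `k(m+1) + r₁ + r₂ + r₃ = m(k+1)`, which is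
        -- `h`.
        linear_combination (m + 1 : ℤ) * key + (p₂ + q₂) * (p₃ + q₃) * b₁ +
          (p₁ + q₁) * (p₃ + q₃) * b₂ + (p₁ + q₁) * (p₂ + q₂) * b₃ +
          (p₁ + q₁) * (p₂ + q₂) * (p₃ + q₃) * h

/-- The number of positive paths whose first step lacks the third mark. -/
theorem mul_ncard_positivePath_first_false {m r₁ r₂ r₃ : ℕ} (h : r₁ + r₂ + r₃ = m) :
    m * (m + 1) * {x : Fin (m + 1) → Bool × Bool × Bool |
      (x 0).2.2 = false ∧ IsPositivePath 1 x ∧ HasMarks (false, false, false) r₁ r₂ r₃ x}.ncard =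
      (r₁ + r₂) * ((m + 1).choose r₁ * (m + 1).choose r₂ * m.choose r₃) := by
  have key := ncard_positivePath_first_step 0 m r₁ r₂ r₃ (fun e => e.2.2 = false)
  simp only [zero_add] at key
  rw [key]
  -- From height 1 the first step leads to height `stepHeight e`, which becomes the starting height
  -- in the ballot theorem.
  have hf := fun e : Bool × Bool × Bool =>
    mul_pathCount_of_false (mul_pathCount m (stepHeight e)) e r₁ r₂ r₃ (by omega)
  have f₁ := hf (false, false, false)
  have f₂ := hf (true, false, false)
  have f₃ := hf (false, true, false)
  have f₄ := hf (true, true, false)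
  simp only [Fintype.sum_prod_type, Fintype.sum_bool, stepHeight, Bool.toNat_true,
    Bool.toNat_false, zero_add, add_zero, if_true, Bool.true_eq_false, if_false] at f₁ f₂ f₃ f₄ ⊢
  have hc : chooseFirst m r₃ false = m.choose r₃ := by simp [chooseFirst]
  rw [hc] at f₁ f₂ f₃ f₄
  have a₁ := chooseFirst_add m r₁
  have a₂ := chooseFirst_add m r₂
  have b₁ := mul_chooseFirst_true m r₁
  have b₂ := mul_chooseFirst_true m r₂
  rw [← a₁] at b₁ ⊢
  rw [← a₂] at b₂ ⊢
  generalize chooseFirst m r₁ false = p₁ at *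
  generalize chooseFirst m r₂ false = p₂ at *
  generalize chooseFirst m r₁ true = q₁ at *
  generalize chooseFirst m r₂ true = q₂ at *
  zify at *
  linear_combination (m + 1 : ℤ) * (f₁ + f₂ + f₃ + f₄) + (p₂ + q₂) * (m.choose r₃) * b₁ +
    (p₁ + q₁) * (m.choose r₃) * b₂

/-! ### Nondecreasing words through letters and repetitions -/

/-- The finite set of letters of a word of natural numbers. -/
def letterSet {m : ℕ} (u : Fin m → ℕ) : Finset ℕ :=
  Finset.univ.image u

/-- The positions at which the letter of a word equals the next letter. -/
def repetitionSet {m : ℕ} (u : Fin m → ℕ) : Finset (Fin m) :=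
  Finset.univ.filter fun i => ∃ h : (i : ℕ) + 1 < m, u i = u ⟨(i : ℕ) + 1, h⟩

theorem mem_letterSet {m : ℕ} {u : Fin m → ℕ} {a : ℕ} : a ∈ letterSet u ↔ ∃ i, u i = a := by
  simp [letterSet]

theorem mem_repetitionSet {m : ℕ} {u : Fin m → ℕ} {i : Fin m} :
    i ∈ repetitionSet u ↔ ∃ h : (i : ℕ) + 1 < m, u i = u ⟨(i : ℕ) + 1, h⟩ := by
  simp [repetitionSet]

theorem sum_toNat_decide {m : ℕ} (p : Fin m → Prop) [DecidablePred p] :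
    ∑ j, (decide (p j)).toNat = (Finset.univ.filter p).card := by
  rw [Finset.card_filter]
  refine Finset.sum_congr rfl fun j _ => ?_
  by_cases h : p j <;> simp [h]

/-- In a nondecreasing word, each letter is preceded by the smaller letters and by repetitions. -/
theorem count_letterSet_add {m : ℕ} {u : Fin m → ℕ} (hu : Monotone u) :
    ∀ (i : ℕ) (hi : i < m), Nat.count (· ∈ letterSet u) (u ⟨i, hi⟩) +
      partialSum (fun j => (decide (j ∈ repetitionSet u)).toNat) i = i := by
  intro i
  induction i with
  | zero =>
    intro hi
    rw [Nat.count_eq_card_filter_range, partialSum_zero, add_zero, Finset.card_eq_zero,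
      Finset.filter_eq_empty_iff]
    intro a ha hm
    obtain ⟨j, rfl⟩ := mem_letterSet.1 hm
    have : u ⟨0, hi⟩ ≤ u j := hu (Nat.zero_le _)
    simp at ha
    omega
  | succ i ih =>
    intro hi
    have hi' : i < m := by omega
    have ih := ih hi'
    rw [partialSum_succ _ hi']
    by_cases hr : (⟨i, hi'⟩ : Fin m) ∈ repetitionSet u
    · obtain ⟨_, h⟩ := mem_repetitionSet.1 hr
      have h : u ⟨i, hi'⟩ = u ⟨i + 1, hi⟩ := h
      rw [← h]
      simp only [hr, decide_true, Bool.toNat_true]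
      omega
    · have hne : u ⟨i, hi'⟩ ≠ u ⟨i + 1, hi⟩ := fun h => hr (mem_repetitionSet.2 ⟨hi, h⟩)
      have hle : u ⟨i, hi'⟩ ≤ u ⟨i + 1, hi⟩ := hu (Nat.le_succ i)
      have hs : (Finset.range (u ⟨i + 1, hi⟩)).filter (· ∈ letterSet u) =
          insert (u ⟨i, hi'⟩) ((Finset.range (u ⟨i, hi'⟩)).filter (· ∈ letterSet u)) := by
        ext a
        simp only [Finset.mem_filter, Finset.mem_range, Finset.mem_insert]
        constructor
        · rintro ⟨ha, hm⟩
          refine or_iff_not_imp_left.2 fun hne' => ⟨?_, hm⟩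
          obtain ⟨j, rfl⟩ := mem_letterSet.1 hm
          rcases Nat.lt_or_ge i j with hj | hj
          · have : u ⟨i + 1, hi⟩ ≤ u j := hu hj
            omega
          · have : u j ≤ u ⟨i, hi'⟩ := hu hj
            omega
        · rintro (rfl | ⟨ha, hm⟩)
          · exact ⟨by omega, mem_letterSet.2 ⟨_, rfl⟩⟩
          · exact ⟨by omega, hm⟩
      have hc : Nat.count (· ∈ letterSet u) (u ⟨i + 1, hi⟩) =
          Nat.count (· ∈ letterSet u) (u ⟨i, hi'⟩) + 1 := by
        rw [Nat.count_eq_card_filter_range, hs, Finset.card_insert_of_notMem (by simp),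
          Nat.count_eq_card_filter_range]
      rw [hc]
      simp only [hr, decide_false, Bool.toNat_false]
      omega

/-- Apply `count_letterSet_add` at the last position: it is never a repetition, and its letter is
the only one not below itself. -/
theorem card_letterSet_add_card_repetitionSet {m : ℕ} {u : Fin m → ℕ} (hu : Monotone u) :
    (letterSet u).card + (repetitionSet u).card = m := by
  cases m with
  | zero => simp [letterSet, repetitionSet]
  | succ m =>
    have h := count_letterSet_add hu m (by omega)
    have hlast : (⟨m, by omega⟩ : Fin (m + 1)) ∉ repetitionSet u := by
      simp [mem_repetitionSet]
    have hR : partialSum (fun j => (decide (j ∈ repetitionSet u)).toNat) m =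
        (repetitionSet u).card := by
      have := partialSum_succ (fun j => (decide (j ∈ repetitionSet u)).toNat) (Nat.lt_succ_self m)
      rw [partialSum_self, sum_toNat_decide] at this
      simpa [hlast] using this.symm
    have hL : letterSet u = insert (u ⟨m, by omega⟩)
        ((Finset.range (u ⟨m, by omega⟩)).filter (· ∈ letterSet u)) := by
      ext a
      simp only [Finset.mem_filter, Finset.mem_range, Finset.mem_insert]
      constructor
      · intro hm
        refine or_iff_not_imp_left.2 fun hne' => ⟨?_, hm⟩
        obtain ⟨j, rfl⟩ := mem_letterSet.1 hm
        have : u j ≤ u ⟨m, by omega⟩ := hu (Nat.lt_succ_iff.1 j.2)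
        omega
      · rintro (rfl | ⟨-, hm⟩)
        · exact mem_letterSet.2 ⟨_, rfl⟩
        · exact hm
    have hc := congrArg Finset.card hL
    rw [Finset.card_insert_of_notMem (by simp)] at hc
    rw [Nat.count_eq_card_filter_range] at h
    omega

/-! ### Odd-position words as positive paths -/

/-- The marks of the `j`-th step of the path of a word record whether the letters `2 * j + 2` and
`2 * j + 1` occur, and whether the letter in position `j` is repeated. -/
def wordPath {m : ℕ} (u : Fin m → ℕ) : Fin m → Bool × Bool × Bool :=
  fun j => (decide (2 * (j : ℕ) + 2 ∈ letterSet u), decide (2 * (j : ℕ) + 1 ∈ letterSet u),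
    decide (j ∈ repetitionSet u))

theorem count_eq_partialSum (m : ℕ) {L : Finset ℕ} (h0 : 0 ∈ L) : ∀ i ≤ m,
    Nat.count (· ∈ L) (2 * i + 1) = 1 + partialSum (fun j : Fin m =>
      (decide (2 * (j : ℕ) + 2 ∈ L)).toNat + (decide (2 * (j : ℕ) + 1 ∈ L)).toNat) i := by
  intro i
  induction i with
  | zero => simp [Nat.count_succ, h0]
  | succ i ih =>
    intro hi
    rw [partialSum_succ _ (show i < m by omega), show 2 * (i + 1) + 1 = 2 * i + 1 + 1 + 1 by ring,
      Nat.count_succ, Nat.count_succ, ih (by omega)]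
    by_cases h1 : 2 * i + 1 ∈ L <;> by_cases h2 : 2 * i + 2 ∈ L <;> simp [h1, h2] <;> omega

/-- The bound on a letter, expressed in terms of the path of the word. -/
theorem letter_le_iff {m : ℕ} {u : Fin m → ℕ} (hu : Monotone u) (h0 : 0 ∈ letterSet u) {i : ℕ}
    (hi : i < m) :
    u ⟨i, hi⟩ ≤ 2 * i ↔ i + 1 ≤ 1 + partialSum (fun j => stepHeight (wordPath u j)) i := by
  have h1 := count_letterSet_add hu i hi
  have h2 := count_eq_partialSum m h0 i hi.le
  have h3 : partialSum (fun j => stepHeight (wordPath u j)) i =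
      partialSum (fun j : Fin m => (decide (2 * (j : ℕ) + 2 ∈ letterSet u)).toNat +
        (decide (2 * (j : ℕ) + 1 ∈ letterSet u)).toNat) i +
      partialSum (fun j => (decide (j ∈ repetitionSet u)).toNat) i := partialSum_add _ _ _
  have hm : u ⟨i, hi⟩ ∈ letterSet u := mem_letterSet.2 ⟨_, rfl⟩
  -- Since `u i` is itself a letter, the count of smaller letters jumps just after it, so comparing
  -- values amounts to comparing counts.
  have key : u ⟨i, hi⟩ ≤ 2 * i ↔ Nat.count (· ∈ letterSet u) (u ⟨i, hi⟩) <
      Nat.count (· ∈ letterSet u) (2 * i + 1) := by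
    constructor
    · exact fun h => Nat.count_strict_mono hm (Nat.lt_succ_iff.2 h)
    · intro h
      by_contra! hlt
      exact absurd (Nat.count_monotone (· ∈ letterSet u) hlt) (not_le.2 h)
  rw [key]
  omega

/-- The subsequences in odd positions of subexcedent faro words. -/
def IsOddWord {m : ℕ} (u : Fin m → ℕ) : Prop :=
  Monotone u ∧ ∀ i, u i ≤ 2 * (i : ℕ)

theorem IsOddWord.zero_mem {m : ℕ} {u : Fin m → ℕ} (hu : IsOddWord u) (hm : 0 < m) :
    0 ∈ letterSet u :=
  mem_letterSet.2 ⟨⟨0, hm⟩, Nat.le_zero.1 (hu.2 ⟨0, hm⟩)⟩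

theorem IsOddWord.lt_of_mem {m : ℕ} {u : Fin m → ℕ} (hu : IsOddWord u) {a : ℕ}
    (ha : a ∈ letterSet u) : a < 2 * m := by
  obtain ⟨i, rfl⟩ := mem_letterSet.1 ha
  have := hu.2 i
  omega

theorem IsOddWord.isPositivePath {m : ℕ} {u : Fin m → ℕ} (hu : IsOddWord u) :
    IsPositivePath 1 (wordPath u) := fun i hi =>
  (letter_le_iff hu.1 (hu.zero_mem (by omega)) hi).1 (hu.2 ⟨i, hi⟩)

theorem sum_toNat_even {m : ℕ} {L : Finset ℕ} (hL : ∀ a ∈ L, a < 2 * m + 1) :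
    ∑ j : Fin m, (decide (2 * (j : ℕ) + 2 ∈ L)).toNat =
      (L.filter fun a => 0 < a ∧ Even a).card := by
  rw [sum_toNat_decide, ← Finset.card_image_of_injective _
    (show Function.Injective fun j : Fin m => 2 * (j : ℕ) + 2 from fun i j h => by
      ext
      simp at h
      omega)]
  congr 1
  ext a
  simp only [Finset.mem_image, Finset.mem_filter, Finset.mem_univ, true_and]
  constructor
  · rintro ⟨j, hj, rfl⟩
    exact ⟨hj, by omega, ⟨j + 1, by ring⟩⟩
  · rintro ⟨ha, hpos, b, rfl⟩
    have := hL _ ha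
    have hb : 2 * (b - 1) + 2 = b + b := by omega
    exact ⟨⟨b - 1, by omega⟩, by simpa [hb] using ha, hb⟩

theorem sum_toNat_odd {m : ℕ} {L : Finset ℕ} (hL : ∀ a ∈ L, a < 2 * m + 1) :
    ∑ j : Fin m, (decide (2 * (j : ℕ) + 1 ∈ L)).toNat = (L.filter fun a => Odd a).card := by
  rw [sum_toNat_decide, ← Finset.card_image_of_injective _
    (show Function.Injective fun j : Fin m => 2 * (j : ℕ) + 1 from fun i j h => by
      ext
      simp at h
      omega)]
  congr 1
  ext a
  simp only [Finset.mem_image, Finset.mem_filter, Finset.mem_univ, true_and]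
  constructor
  · rintro ⟨j, hj, rfl⟩
    exact ⟨hj, ⟨j, rfl⟩⟩
  · rintro ⟨ha, b, rfl⟩
    have := hL _ ha
    exact ⟨⟨b, by omega⟩, ha, rfl⟩

theorem card_eq_one_add {L : Finset ℕ} (h0 : 0 ∈ L) :
    L.card = 1 + (L.filter fun a => 0 < a ∧ Even a).card + (L.filter fun a => Odd a).card := by
  have h : L.filter (fun a => ¬ Odd a) = insert 0 (L.filter fun a => 0 < a ∧ Even a) := by
    ext a
    simp only [Finset.mem_filter, Finset.mem_insert, Nat.not_odd_iff_even]
    constructor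
    · rintro ⟨ha, he⟩
      exact or_iff_not_imp_left.2 fun hne => ⟨ha, Nat.pos_of_ne_zero hne, he⟩
    · rintro (rfl | ⟨ha, -, he⟩)
      · exact ⟨h0, Even.zero⟩
      · exact ⟨ha, he⟩
  rw [← Finset.card_filter_add_card_filter_not (s := L) (fun a => Odd a), h,
    Finset.card_insert_of_notMem (by simp)]
  omega

theorem IsOddWord.hasMarks_iff {m : ℕ} {u : Fin m → ℕ} (hu : IsOddWord u) (r₁ r₂ r₃ : ℕ) :
    HasMarks (false, false, false) r₁ r₂ r₃ (wordPath u) ↔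
      ((letterSet u).filter fun a => 0 < a ∧ Even a).card = r₁ ∧
      ((letterSet u).filter fun a => Odd a).card = r₂ ∧ (repetitionSet u).card = r₃ := by
  have hL : ∀ a ∈ letterSet u, a < 2 * m + 1 := fun a ha => (hu.lt_of_mem ha).trans (by omega)
  simp only [HasMarks, wordPath, sum_toNat_even hL, sum_toNat_odd hL, sum_toNat_decide,
    Bool.toNat_false, zero_add, Finset.filter_univ_mem]

/-- The marks recover all letters, because 0 always occurs and no letter reaches `2m`. The letter at
`i` is then the one whose number of smaller letters is `i` minus the earlier repetitions. -/
theorem wordPath_injOn (m : ℕ) : Set.InjOn wordPath {u : Fin m → ℕ | IsOddWord u} := by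
  intro u hu v hv h
  have hu : IsOddWord u := hu
  have hv : IsOddWord v := hv
  have h1 : ∀ j : Fin m, 2 * (j : ℕ) + 2 ∈ letterSet u ↔ 2 * (j : ℕ) + 2 ∈ letterSet v :=
    fun j => by simpa [wordPath] using congrArg (fun x => (x j).1) h
  have h2 : ∀ j : Fin m, 2 * (j : ℕ) + 1 ∈ letterSet u ↔ 2 * (j : ℕ) + 1 ∈ letterSet v :=
    fun j => by simpa [wordPath] using congrArg (fun x => (x j).2.1) h
  have h3 : repetitionSet u = repetitionSet v := by
    ext j
    simpa [wordPath] using congrArg (fun x => (x j).2.2) h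
  ext i
  have hm : 0 < m := i.pos
  have hL : letterSet u = letterSet v := by
    ext a
    by_cases ha : a < 2 * m
    · rcases Nat.even_or_odd' a with ⟨b, rfl | rfl⟩
      · cases b with
        | zero => simp [hu.zero_mem hm, hv.zero_mem hm]
        | succ b => exact h1 ⟨b, by omega⟩
      · exact h2 ⟨b, by omega⟩
    · exact ⟨fun h => absurd (hu.lt_of_mem h) ha, fun h => absurd (hv.lt_of_mem h) ha⟩
  have cu := count_letterSet_add hu.1 i i.2
  have cv := count_letterSet_add hv.1 i i.2
  rw [← hL, ← h3] at cv
  refine Nat.count_injective (p := (· ∈ letterSet u)) (mem_letterSet.2 ⟨i, rfl⟩)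
    (hL ▸ mem_letterSet.2 ⟨i, rfl⟩) ?_
  simp only [Fin.eta] at cu cv
  omega

/-- A nondecreasing word can be prescribed by its letters and its repetitions. -/
theorem exists_letterSet_repetitionSet {m : ℕ} {L : Finset ℕ} {R : Finset (Fin m)}
    (hR : ∀ i ∈ R, (i : ℕ) + 1 < m) (hc : L.card + R.card = m) :
    ∃ u : Fin m → ℕ, Monotone u ∧ letterSet u = L ∧ repetitionSet u = R := by
  -- The rank in `L` of the letter at `i`: it grows by one after each position outside `R`.
  let p : ℕ → ℕ := partialSum fun j => (decide (j ∉ R)).toNat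
  have hp : ∀ (i : ℕ) (hi : i < m), p (i + 1) = p i + (decide (⟨i, hi⟩ ∉ R)).toNat :=
    fun i hi => partialSum_succ _ hi
  have hmono : Monotone p := fun i j hij =>
    Finset.sum_le_sum_of_subset fun a ha => by
      simp only [Finset.mem_filter, Finset.mem_univ, true_and] at ha ⊢
      omega
  have hpm : p m = L.card := by
    have h1 : p m = (Finset.univ.filter fun j => j ∉ R).card := by
      rw [← sum_toNat_decide]
      exact partialSum_self _
    have h2 := Finset.card_filter_add_card_filter_not (s := (Finset.univ : Finset (Fin m)))
      (fun j => j ∈ R)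
    rw [Finset.filter_univ_mem, Finset.card_univ, Fintype.card_fin] at h2
    omega
  have hlt : ∀ i < m, p i < L.card := by
    intro i hi
    -- The last position lies outside `R`, so the rank still grows after it and stays below `L.card`
    -- at every position.
    have hlast : (⟨m - 1, by omega⟩ : Fin m) ∉ R := fun h => by
      have := hR _ h
      simp at this
      omega
    have h1 := hp (m - 1) (by omega)
    rw [Nat.sub_add_cancel (by omega), hpm] at h1
    simp only [hlast, not_false_eq_true, decide_true, Bool.toNat_true] at h1
    have h2 : p i ≤ p (m - 1) := hmono (by omega)
    omega
  let u : Fin m → ℕ := fun i => L.orderEmbOfFin rfl ⟨p i, hlt i i.2⟩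
  have hu : Monotone u := fun i j hij =>
    (L.orderEmbOfFin rfl).monotone (show p i ≤ p j from hmono hij)
  have hrep : repetitionSet u = R := by
    ext i
    rw [mem_repetitionSet]
    have key : ∀ h : (i : ℕ) + 1 < m, u i = u ⟨(i : ℕ) + 1, h⟩ ↔ i ∈ R := by
      intro h
      have h1 := hp i i.2
      simp only [u, EmbeddingLike.apply_eq_iff_eq, Fin.mk.injEq]
      rw [h1]
      by_cases hi : i ∈ R <;> simp [hi]
    exact ⟨fun ⟨h, e⟩ => (key h).1 e, fun h => ⟨hR i h, (key (hR i h)).2 h⟩⟩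
  refine ⟨u, hu, ?_, hrep⟩
  refine Finset.eq_of_subset_of_card_le ?_ ?_
  · intro a ha
    obtain ⟨i, rfl⟩ := mem_letterSet.1 ha
    exact L.orderEmbOfFin_mem rfl _
  · have := card_letterSet_add_card_repetitionSet hu
    rw [hrep] at this
    omega

theorem exists_wordPath_eq {m r₁ r₂ r₃ : ℕ} (hm : r₁ + r₂ + r₃ + 1 = m)
    {x : Fin m → Bool × Bool × Bool} (hx : IsPositivePath 1 x)
    (hr : HasMarks (false, false, false) r₁ r₂ r₃ x) : ∃ u, IsOddWord u ∧ wordPath u = x := by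
  let L : Finset ℕ := (Finset.range (2 * m + 1)).filter fun a => a = 0 ∨
    (∃ j : Fin m, (x j).1 = true ∧ 2 * (j : ℕ) + 2 = a) ∨
    ∃ j : Fin m, (x j).2.1 = true ∧ 2 * (j : ℕ) + 1 = a
  let R : Finset (Fin m) := Finset.univ.filter fun j => (x j).2.2 = true
  have h0 : 0 ∈ L := by simp [L]
  have hL : ∀ a ∈ L, a < 2 * m + 1 := fun a ha => by simpa using (Finset.mem_filter.1 ha).1
  have h1 : ∀ j : Fin m, decide (2 * (j : ℕ) + 2 ∈ L) = (x j).1 := by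
    intro j
    rw [Bool.eq_iff_iff, decide_eq_true_iff]
    simp only [L, Finset.mem_filter, Finset.mem_range]
    constructor
    · rintro ⟨-, h | ⟨i, hi, e⟩ | ⟨i, hi, e⟩⟩
      · omega
      · rwa [show j = i from Fin.ext (by omega)]
      · omega
    · exact fun h => ⟨by omega, Or.inr (Or.inl ⟨j, h, rfl⟩)⟩
  have h2 : ∀ j : Fin m, decide (2 * (j : ℕ) + 1 ∈ L) = (x j).2.1 := by
    intro j
    rw [Bool.eq_iff_iff, decide_eq_true_iff]
    simp only [L, Finset.mem_filter, Finset.mem_range]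
    constructor
    · rintro ⟨-, h | ⟨i, hi, e⟩ | ⟨i, hi, e⟩⟩
      · omega
      · omega
      · rwa [show j = i from Fin.ext (by omega)]
    · exact fun h => ⟨by omega, Or.inr (Or.inr ⟨j, h, rfl⟩)⟩
  have h3 : ∀ j : Fin m, decide (j ∈ R) = (x j).2.2 := fun j => by simp [R]
  have s1 := sum_toNat_even hL
  have s2 := sum_toNat_odd hL
  have s3 : ∑ j, (decide (j ∈ R)).toNat = R.card := by
    rw [sum_toNat_decide, Finset.filter_univ_mem]
  simp only [h1, h2, h3] at s1 s2 s3
  obtain ⟨m₁, m₂, m₃⟩ := hr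
  simp only [Bool.toNat_false, zero_add, s1, s2, s3] at m₁ m₂ m₃
  have hcard := card_eq_one_add h0
  -- The height is at least 1 before the last step and 0 after it, so the last step has no marks; in
  -- particular the last position is not in `R`.
  have hR : ∀ i ∈ R, (i : ℕ) + 1 < m := by
    intro i hi
    by_contra hlast
    have hm1 : (i : ℕ) = m - 1 := by omega
    have ht := partialSum_succ (fun j => stepHeight (x j)) i.2
    rw [show (i : ℕ) + 1 = m by omega, partialSum_self] at ht
    have hpos := hx i i.2
    have hh : 1 ≤ stepHeight (x i) := by
      have : (x i).2.2 = true := by simpa [R] using hi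
      simp [stepHeight, this]
    have htot : ∑ j, stepHeight (x j) = r₁ + r₂ + r₃ := by
      simp only [stepHeight, Finset.sum_add_distrib, s1, s2, s3, m₁, m₂, m₃]
    simp only [Fin.eta] at ht
    omega
  obtain ⟨u, hu, hLu, hRu⟩ := exists_letterSet_repetitionSet hR
    (show L.card + R.card = m by omega)
  have hux : wordPath u = x := by
    ext1 j
    simp only [wordPath, hLu, hRu, h1, h2, h3]
  refine ⟨u, ⟨hu, fun i => ?_⟩, hux⟩
  rw [letter_le_iff hu (hLu ▸ h0) i.2, hux]
  exact hx i i.2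

/-- The words of the odd positions, counted by paths with an arbitrary restriction. -/
theorem ncard_isOddWord {m r₁ r₂ r₃ : ℕ} (hm : r₁ + r₂ + r₃ + 1 = m)
    (P : (Fin m → Bool × Bool × Bool) → Prop) :
    {u : Fin m → ℕ | P (wordPath u) ∧ IsOddWord u ∧
      ((letterSet u).filter fun a => 0 < a ∧ Even a).card = r₁ ∧
      ((letterSet u).filter fun a => Odd a).card = r₂ ∧ (repetitionSet u).card = r₃}.ncard =
    {x | P x ∧ IsPositivePath 1 x ∧ HasMarks (false, false, false) r₁ r₂ r₃ x}.ncard := by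
  rw [← Set.InjOn.ncard_image ((wordPath_injOn m).mono fun u hu => hu.2.1)]
  congr 1
  ext x
  constructor
  · rintro ⟨u, ⟨hP, hu, hr⟩, rfl⟩
    exact ⟨hP, hu.isPositivePath, (hu.hasMarks_iff _ _ _).2 hr⟩
  · rintro ⟨hP, hx, hr⟩
    obtain ⟨u, hu, rfl⟩ := exists_wordPath_eq hm hx hr
    exact ⟨u, ⟨hP, hu, (hu.hasMarks_iff _ _ _).1 hr⟩, rfl⟩

/-! ### Even-position words, reduced to odd-position words -/

/-- The subsequences in even positions of subexcedent faro words. -/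
def IsEvenWord {m : ℕ} (v : Fin m → ℕ) : Prop :=
  Monotone v ∧ ∀ i, v i ≤ 2 * (i : ℕ) + 1

/-- The word obtained by raising all letters by one and prepending a zero. -/
def shiftWord {m : ℕ} (v : Fin m → ℕ) : Fin (m + 1) → ℕ :=
  Fin.cons 0 fun i => v i + 1

@[simp]
theorem shiftWord_zero {m : ℕ} (v : Fin m → ℕ) : shiftWord v 0 = 0 := rfl

@[simp]
theorem shiftWord_succ {m : ℕ} (v : Fin m → ℕ) (i : Fin m) : shiftWord v i.succ = v i + 1 := rfl

theorem shiftWord_injective (m : ℕ) : Function.Injective (shiftWord : (Fin m → ℕ) → _) := by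
  intro v w h
  ext i
  simpa using congrFun h i.succ

theorem isOddWord_shiftWord {m : ℕ} {v : Fin m → ℕ} : IsOddWord (shiftWord v) ↔ IsEvenWord v := by
  constructor
  · rintro ⟨hm, hb⟩
    refine ⟨fun i j hij => ?_, fun i => ?_⟩
    · simpa using hm (Fin.succ_le_succ_iff.2 hij)
    · have := hb i.succ
      simp only [shiftWord_succ, Fin.val_succ] at this
      omega
  · rintro ⟨hm, hb⟩
    refine ⟨fun i j hij => ?_, fun i => ?_⟩
    · cases i using Fin.cases with
      | zero => simp
      | succ i =>
        cases j using Fin.cases with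
        | zero => simp at hij
        | succ j => simpa using hm (Fin.succ_le_succ_iff.1 hij)
    · cases i using Fin.cases with
      | zero => simp
      | succ i =>
        have := hb i
        simp only [shiftWord_succ, Fin.val_succ]
        omega

theorem letterSet_shiftWord {m : ℕ} (v : Fin m → ℕ) :
    letterSet (shiftWord v) = insert 0 ((letterSet v).image (· + 1)) := by
  ext a
  simp [mem_letterSet, Fin.exists_fin_succ, eq_comm]

theorem card_even_letterSet_shiftWord {m : ℕ} (v : Fin m → ℕ) :
    ((letterSet (shiftWord v)).filter fun a => 0 < a ∧ Even a).card =
      ((letterSet v).filter fun a => Odd a).card := by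
  rw [letterSet_shiftWord, Finset.filter_insert, if_neg (by simp), Finset.filter_image,
    Finset.card_image_of_injective _ (add_left_injective 1)]
  simp [Nat.even_add_one]

theorem card_odd_letterSet_shiftWord {m : ℕ} (v : Fin m → ℕ) :
    ((letterSet (shiftWord v)).filter fun a => Odd a).card =
      ((letterSet v).filter fun a => Even a).card := by
  rw [letterSet_shiftWord, Finset.filter_insert, if_neg (by simp), Finset.filter_image,
    Finset.card_image_of_injective _ (add_left_injective 1)]
  simp [Nat.odd_add_one]

theorem zero_notMem_repetitionSet_shiftWord {m : ℕ} (v : Fin m → ℕ) :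
    0 ∉ repetitionSet (shiftWord v) := by
  rw [mem_repetitionSet]
  rintro ⟨h, e⟩
  have : shiftWord v 0 = shiftWord v (Fin.succ ⟨0, by simpa using h⟩) := e
  rw [shiftWord_zero, shiftWord_succ] at this
  omega

theorem repetitionSet_shiftWord {m : ℕ} (v : Fin m → ℕ) :
    repetitionSet (shiftWord v) = (repetitionSet v).map (Fin.succEmb m) := by
  ext i
  cases i using Fin.cases with
  | zero => simp [zero_notMem_repetitionSet_shiftWord]
  | succ i =>
    have key : i.succ ∈ repetitionSet (shiftWord v) ↔ i ∈ repetitionSet v := by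
      rw [mem_repetitionSet, mem_repetitionSet]
      have h : ∀ h : (i : ℕ) + 1 < m, shiftWord v ⟨(i.succ : ℕ) + 1, by simpa using h⟩ =
          v ⟨(i : ℕ) + 1, h⟩ + 1 := fun _ => rfl
      constructor
      · rintro ⟨h1, e⟩
        have h2 : (i : ℕ) + 1 < m := by simpa using h1
        rw [h h2] at e
        exact ⟨h2, by simpa using e⟩
      · rintro ⟨h1, e⟩
        refine ⟨by simpa using h1, ?_⟩
        rw [h h1, shiftWord_succ, e]
    simp [key]

/-- The first letter is 0 and is not repeated, so by monotonicity all later letters are positive and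
can be lowered by one. -/
theorem exists_shiftWord_eq {m : ℕ} {u : Fin (m + 1) → ℕ} (hu : IsOddWord u)
    (h0 : 0 ∉ repetitionSet u) : ∃ v, shiftWord v = u := by
  refine ⟨fun i => u i.succ - 1, ?_⟩
  have hz : u 0 = 0 := Nat.le_zero.1 (hu.2 0)
  ext i
  cases i using Fin.cases with
  | zero => rw [shiftWord_zero, hz]
  | succ i =>
    have h1 : 0 + 1 < m + 1 := Nat.succ_lt_succ i.pos
    have hne : u ⟨0 + 1, h1⟩ ≠ 0 := fun h => h0 (mem_repetitionSet.2 ⟨h1, by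
      rw [hz]
      exact h.symm⟩)
    have hle : u ⟨0 + 1, h1⟩ ≤ u i.succ := hu.1 (by simp [Fin.le_def])
    rw [shiftWord_succ]
    omega

/-- Raising the letters exchanges parities, hence the swap of `r₁` and `r₂` in the path count. -/
theorem ncard_isEvenWord {m r₁ r₂ r₃ : ℕ} (hm : r₁ + r₂ + r₃ = m) :
    {v : Fin m → ℕ | IsEvenWord v ∧ ((letterSet v).filter fun a => Even a).card = r₁ ∧
      ((letterSet v).filter fun a => Odd a).card = r₂ ∧ (repetitionSet v).card = r₃}.ncard =
    {x : Fin (m + 1) → Bool × Bool × Bool | (x 0).2.2 = false ∧ IsPositivePath 1 x ∧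
      HasMarks (false, false, false) r₂ r₁ r₃ x}.ncard := by
  rw [← ncard_isOddWord (by omega) fun x => (x 0).2.2 = false,
    ← Set.InjOn.ncard_image (shiftWord_injective m).injOn]
  congr 1
  ext u
  constructor
  · rintro ⟨v, ⟨hv, h1, h2, h3⟩, rfl⟩
    refine ⟨by simp [wordPath, zero_notMem_repetitionSet_shiftWord], isOddWord_shiftWord.2 hv,
      (card_even_letterSet_shiftWord v).trans h2, (card_odd_letterSet_shiftWord v).trans h1, ?_⟩
    rw [repetitionSet_shiftWord, Finset.card_map, h3]
  · rintro ⟨h0, hu, h2, h1, h3⟩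
    obtain ⟨v, rfl⟩ := exists_shiftWord_eq hu (by simpa [wordPath] using h0)
    rw [repetitionSet_shiftWord, Finset.card_map] at h3
    exact ⟨v, ⟨isOddWord_shiftWord.1 hu, (card_odd_letterSet_shiftWord v).symm.trans h1,
      (card_even_letterSet_shiftWord v).symm.trans h2, h3⟩, rfl⟩

/-! ### Splitting faro words into their two subsequences -/

/-- The word of natural numbers underlying a word over a finite alphabet. -/
def toNatWord {m k : ℕ} (u : Fin m → Fin k) : Fin m → ℕ := fun i => u i

theorem letters_eq {m k : ℕ} (u : Fin m → Fin k) : letters u = letterSet (toNatWord u) := rfl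

theorem repetitions_eq {m k : ℕ} (u : Fin m → Fin k) :
    repetitions u = (repetitionSet (toNatWord u)).card := by
  rw [repetitions]
  congr 1
  ext i
  rw [mem_repetitionSet]
  simp [toNatWord, Fin.ext_iff]

theorem oddPart_faroShuffle {n k : ℕ} (u : Fin ((n + 1) / 2) → Fin k) (v : Fin (n / 2) → Fin k) :
    oddPart (faroShuffle u v) = u := by
  ext i
  simp [oddPart, faroShuffle]

theorem evenPart_faroShuffle {n k : ℕ} (u : Fin ((n + 1) / 2) → Fin k) (v : Fin (n / 2) → Fin k) :
    evenPart (faroShuffle u v) = v := by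
  ext i
  have h1 : (2 * (i : ℕ) + 1) / 2 = i := by omega
  simp [evenPart, faroShuffle, h1]

theorem faroShuffle_oddPart_evenPart {n k : ℕ} (w : Fin n → Fin k) :
    faroShuffle (oddPart w) (evenPart w) = w := by
  ext i
  simp only [faroShuffle, oddPart, evenPart]
  split_ifs with h
  · have h1 : 2 * ((i : ℕ) / 2) = i := by omega
    simp [h1]
  · have h1 : 2 * ((i : ℕ) / 2) + 1 = i := by omega
    simp [h1]

theorem isFaro_iff {n k : ℕ} {w : Fin n → Fin k} :
    IsFaro w ↔ Monotone (oddPart w) ∧ Monotone (evenPart w) := by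
  constructor
  · rintro ⟨u, v, hu, hv, rfl⟩
    rw [oddPart_faroShuffle, evenPart_faroShuffle]
    exact ⟨hu, hv⟩
  · rintro ⟨hu, hv⟩
    exact ⟨_, _, hu, hv, (faroShuffle_oddPart_evenPart w).symm⟩

theorem isSubexcedent_iff {n k : ℕ} {w : Fin n → Fin k} :
    IsSubexcedent w ↔ (∀ i, toNatWord (oddPart w) i ≤ 2 * (i : ℕ)) ∧
      ∀ i, toNatWord (evenPart w) i ≤ 2 * (i : ℕ) + 1 := by
  constructor
  · exact fun h => ⟨fun i => h _, fun i => h _⟩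
  · rintro ⟨h1, h2⟩ i
    by_cases h : (i : ℕ) % 2 = 0
    · have := h1 ⟨i / 2, by omega⟩
      have e : 2 * ((i : ℕ) / 2) = i := by omega
      simpa only [toNatWord, oddPart, e] using this
    · have := h2 ⟨i / 2, by omega⟩
      have e : 2 * ((i : ℕ) / 2) + 1 = i := by omega
      simpa only [toNatWord, evenPart, e] using this

theorem monotone_toNatWord {m k : ℕ} {u : Fin m → Fin k} : Monotone (toNatWord u) ↔ Monotone u :=
  Iff.rfl

theorem mem_subexcedentFaroWords {n : ℕ} {w : Fin n → Fin n} :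
    w ∈ subexcedentFaroWords n ↔
      IsOddWord (toNatWord (oddPart w)) ∧ IsEvenWord (toNatWord (evenPart w)) := by
  change IsFaro w ∧ IsSubexcedent w ↔ _
  rw [isFaro_iff, isSubexcedent_iff, IsOddWord, IsEvenWord, monotone_toNatWord,
    monotone_toNatWord]
  tauto

/-- The two subsequences of a subexcedent faro word are independent of each other. -/
theorem ncard_subexcedentFaroWords (n r₁ r₂ r₃ r₄ r₅ r₆ : ℕ) :
    {w ∈ subexcedentFaroWords n | (eOdis w, oOdis w, aOrpt w, eEdis w, oEdis w, aErpt w) =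
      (r₁, r₂, r₃, r₄, r₅, r₆)}.ncard =
    {u : Fin ((n + 1) / 2) → ℕ | IsOddWord u ∧
      ((letterSet u).filter fun a => 0 < a ∧ Even a).card = r₁ ∧
      ((letterSet u).filter fun a => Odd a).card = r₂ ∧ (repetitionSet u).card = r₃}.ncard *
    {v : Fin (n / 2) → ℕ | IsEvenWord v ∧ ((letterSet v).filter fun a => Even a).card = r₄ ∧
      ((letterSet v).filter fun a => Odd a).card = r₅ ∧ (repetitionSet v).card = r₆}.ncard := by
  rw [← Set.ncard_prod]
  have hinj : Function.Injective fun w : Fin n → Fin n =>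
      (toNatWord (oddPart w), toNatWord (evenPart w)) := by
    intro w w' h
    obtain ⟨h1, h2⟩ := Prod.mk.inj h
    have e1 : oddPart w = oddPart w' := funext fun i => Fin.ext (congrFun h1 i)
    have e2 : evenPart w = evenPart w' := funext fun i => Fin.ext (congrFun h2 i)
    rw [← faroShuffle_oddPart_evenPart w, e1, e2, faroShuffle_oddPart_evenPart]
  rw [← Set.InjOn.ncard_image hinj.injOn]
  congr 1
  ext ⟨u, v⟩
  constructor
  · rintro ⟨w, ⟨hw, hs⟩, h⟩
    obtain ⟨rfl, rfl⟩ := Prod.mk.inj h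
    obtain ⟨ho, he⟩ := mem_subexcedentFaroWords.1 hw
    simp only [eOdis, oOdis, aOrpt, eEdis, oEdis, aErpt, letters_eq, repetitions_eq,
      Prod.mk.injEq] at hs
    obtain ⟨s1, s2, s3, s4, s5, s6⟩ := hs
    exact ⟨⟨ho, s1, s2, s3⟩, he, s4, s5, s6⟩
  · rintro ⟨⟨ho, s1, s2, s3⟩, he, s4, s5, s6⟩
    dsimp only at ho s1 s2 s3 he s4 s5 s6
    -- The subexcedent bounds force all letters below `n`, so the alphabet `Fin n` imposes no
    -- further restriction.
    have hu : ∀ i, u i < n := fun i => by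
      have := ho.2 i
      omega
    have hv : ∀ i, v i < n := fun i => by
      have := he.2 i
      omega
    let w : Fin n → Fin n := faroShuffle (fun i => ⟨u i, hu i⟩) fun i => ⟨v i, hv i⟩
    have h1 : toNatWord (oddPart w) = u := by
      simp only [w, oddPart_faroShuffle]
      rfl
    have h2 : toNatWord (evenPart w) = v := by
      simp only [w, evenPart_faroShuffle]
      rfl
    refine ⟨w, ⟨?_, ?_⟩, Prod.ext h1 h2⟩
    · rw [mem_subexcedentFaroWords, h1, h2]
      exact ⟨ho, he⟩
    · simp only [eOdis, oOdis, aOrpt, eEdis, oEdis, aErpt, letters_eq, repetitions_eq, h1, h2,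
        s1, s2, s3, s4, s5, s6]

end FaroWord

theorem mainTheorem11 (n nₒ nₑ : ℕ) (hn : 2 ≤ n) (hnₒ : nₒ = (n + 1) / 2) (hnₑ : nₑ = n / 2) :
    (∀ w ∈ FaroWord.subexcedentFaroWords n,
      FaroWord.eOdis w + FaroWord.oOdis w + FaroWord.aOrpt w + 1 = nₒ ∧
      FaroWord.eEdis w + FaroWord.oEdis w + FaroWord.aErpt w = nₑ) ∧
    ∀ r₁ r₂ r₃ r₄ r₅ r₆ : ℕ, r₁ + r₂ + r₃ + 1 = nₒ → r₄ + r₅ + r₆ = nₑ →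
      (Set.ncard {w ∈ FaroWord.subexcedentFaroWords n |
          (FaroWord.eOdis w, FaroWord.oOdis w, FaroWord.aOrpt w,
            FaroWord.eEdis w, FaroWord.oEdis w, FaroWord.aErpt w) = (r₁, r₂, r₃, r₄, r₅, r₆)} : ℚ)
        = 1 / (nₒ : ℚ) * (nₒ.choose r₁ : ℚ) * (nₒ.choose r₂ : ℚ) * (nₒ.choose r₃ : ℚ)
          * (((r₄ : ℚ) + (r₅ : ℚ)) / ((nₑ : ℚ) * ((nₑ : ℚ) + 1)))
          * ((nₑ + 1).choose r₄ : ℚ) * ((nₑ + 1).choose r₅ : ℚ) * (nₑ.choose r₆ : ℚ) := by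
  open FaroWord in
  constructor
  · intro w hw
    obtain ⟨ho, he⟩ := mem_subexcedentFaroWords.1 hw
    have o1 := card_letterSet_add_card_repetitionSet ho.1
    have o2 := card_eq_one_add (ho.zero_mem (by omega))
    have e1 := card_letterSet_add_card_repetitionSet he.1
    have e2 := Finset.card_filter_add_card_filter_not
      (s := letterSet (toNatWord (evenPart w))) (fun a => Even a)
    simp only [Nat.not_even_iff_odd] at e2
    simp only [eOdis, oOdis, aOrpt, eEdis, oEdis, aErpt, letters_eq, repetitions_eq]
    omega
  · intro r₁ r₂ r₃ r₄ r₅ r₆ hr hs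
    have ho := ncard_isOddWord hr fun _ => True
    simp only [true_and] at ho
    have hp := mul_pathCount nₒ 1 r₁ r₂ r₃ hr
    rw [pathCount, ← ho] at hp
    have hq := mul_ncard_positivePath_first_false (m := nₑ) (r₁ := r₅) (r₂ := r₄) (r₃ := r₆)
      (by omega)
    rw [← ncard_isEvenWord hs] at hq
    rw [ncard_subexcedentFaroWords, ← hnₒ, ← hnₑ]
    have h1 : (nₒ : ℚ) ≠ 0 := by
      have : nₒ ≠ 0 := by omega
      exact_mod_cast this
    have h2 : (nₑ : ℚ) ≠ 0 := by
      have : nₑ ≠ 0 := by omega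
      exact_mod_cast this
    have h3 : (nₑ : ℚ) + 1 ≠ 0 := by positivity
    generalize Set.ncard _ = A at hp ⊢
    generalize Set.ncard _ = B at hq ⊢
    have hp' := congrArg (Nat.cast : ℕ → ℚ) hp
    have hq' := congrArg (Nat.cast : ℕ → ℚ) hq
    push_cast at hp' hq' ⊢
    have hA : (A : ℚ) = 1 / (nₒ : ℚ) * (nₒ.choose r₁ * nₒ.choose r₂ * nₒ.choose r₃) := by
      field_simp
      linear_combination hp'
    have hB : (B : ℚ) = ((r₄ : ℚ) + r₅) / ((nₑ : ℚ) * ((nₑ : ℚ) + 1)) *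
        ((nₑ + 1).choose r₄ * (nₑ + 1).choose r₅ * nₑ.choose r₆) := by
      field_simp
      linear_combination hq'
    rw [hA, hB]
    ring
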